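/- Let $n\ge 1$ and let $\zeta\in\mathbb C$ satisfy $\operatorname{Re}\zeta=n/2$, $\zeta\ne n/2$. On hyperbolic half-space $\mathbb H^{n+1}=\{(x,y):x>0,\ y\in\mathbb R^n\}$ put $$E_\zeta((x,y),y')=c_\zeta\Bigl[\frac{x}{x^2+|y-y'|^2}\Bigr]^{\zeta},\qquad c_\zeta=\pi^{-n/2}2^{-2\zeta-1}\frac{\Gamma(\zeta)}{\Gamma(\zeta-\frac n2+1)},$$ and for $f\in C_c^\infty(\mathbb R^n)$ let $$u(x,y)=2^{2\zeta}(2\zeta-n)\int_{\mathbb R^n}E_\zeta((x,y),y')f(y')\,dy'.$$ Then $$u(x,y)=x^{n-\zeta}f(y)+x^{\zeta}f'(y)+O(x^{n/2+1})\quad\text{as }x\to0^+,$$ uniformly in $y\in\mathbb R^n$; more precisely, there is a constant $C$ depending only on $n,\zeta,f$ such that the error is at most $Cx^{n/2+1}$ for all $0<x\le1$ and $y\in\mathbb R^n$. Here $f'=S_\zeta f$, where $$(S_\zeta f)(y)=(2\pi)^{-n}\int_{\mathbb R^n}e^{iy\cdot\xi}\,a(y,\xi)\,\hat f(\xi)\,d\xi,\qquad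 \hat f(\xi)=\int_{\mathbb R^n}e^{-iw\cdot\xi}f(w)\,dw,$$ is the pseudodifferential operator on $\mathbb R^n$ with total symbol $$a(y,\xi)=2^{n-2\zeta}\,\frac{\Gamma(\frac n2-\zeta)}{\Gamma(\zeta-\frac n2)}\,|\xi|^{2\zeta-n}.$$ It is of order zero: $a$ is smooth for $\xi\ne0$, and for all $j,k\ge 0$ there is a constant $C_{j,k}$ with $|\partial_y^j\partial_\xi^k a(y,\xi)|\le C_{j,k}(1+|\xi|)^{-k}$ for all $y$ and all $|\xi|\ge1$. -/

import Mathlib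

open scoped ContDiff

noncomputable section

/-- The normalizing constant
`c_ζ = π^(-n/2) 2^(-2ζ-1) Γ(ζ) / Γ(ζ - n/2 + 1)`. -/
def cZeta (n : ℕ) (ζ : ℂ) : ℂ :=
  (Real.pi : ℂ) ^ (-(n : ℂ) / 2) * (2 : ℂ) ^ (-2 * ζ - 1) *
    (Complex.Gamma ζ / Complex.Gamma (ζ - (n : ℂ) / 2 + 1))

/-- The generalized eigenfunction
`E_ζ((x, y), y') = c_ζ [x / (x² + |y - y'|²)]^ζ` on hyperbolic half-space with
coordinates `x > 0`, `y ∈ ℝⁿ`. -/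
def eigenKernel (n : ℕ) (ζ : ℂ) (x : ℝ) (y y' : EuclideanSpace ℝ (Fin n)) : ℂ :=
  cZeta n ζ * ((x / (x ^ 2 + ‖y - y'‖ ^ 2) : ℝ) : ℂ) ^ ζ

/-- The Poisson integral `u(x, y) = 2^(2ζ) (2ζ - n) ∫ E_ζ((x, y), y') f(y') dy'`. -/
def poissonIntegral (n : ℕ) (ζ : ℂ) (f : EuclideanSpace ℝ (Fin n) → ℂ)
    (x : ℝ) (y : EuclideanSpace ℝ (Fin n)) : ℂ :=
  (2 : ℂ) ^ (2 * ζ) * (2 * ζ - (n : ℂ)) * ∫ y', eigenKernel n ζ x y y' * f y'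

/-- The Fourier transform `f̂(ξ) = ∫ e^(-i w·ξ) f(w) dw`. -/
def fourierHat (n : ℕ) (f : EuclideanSpace ℝ (Fin n) → ℂ)
    (ξ : EuclideanSpace ℝ (Fin n)) : ℂ :=
  ∫ w, Complex.exp (-(Complex.I * ((inner ℝ w ξ : ℝ) : ℂ))) * f w

/-- The operator with total symbol `a(y, ξ)`:
`(Op(a) f)(y) = (2π)^(-n) ∫ e^(i y·ξ) a(y, ξ) f̂(ξ) dξ`. -/
def pseudoDiffOp (n : ℕ)
    (a : EuclideanSpace ℝ (Fin n) → EuclideanSpace ℝ (Fin n) → ℂ)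
    (f : EuclideanSpace ℝ (Fin n) → ℂ) (y : EuclideanSpace ℝ (Fin n)) : ℂ :=
  ((2 * (Real.pi : ℂ)) ^ n)⁻¹ *
    ∫ ξ, Complex.exp (Complex.I * ((inner ℝ y ξ : ℝ) : ℂ)) * a y ξ * fourierHat n f ξ

/-- `a(y, ξ)` is a symbol of order `m`, i.e. it is smooth for `ξ ≠ 0` and, for `|ξ| ≥ 1`,
`|∂_y^j ∂_ξ^k a(y, ξ)| ≤ C_{j,k} (1 + |ξ|)^(m - k)`. A singularity at `ξ = 0` is allowed,
as usual for homogeneous symbols. -/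
def IsSymbolOfOrder (n : ℕ) (m : ℝ)
    (a : EuclideanSpace ℝ (Fin n) → EuclideanSpace ℝ (Fin n) → ℂ) : Prop :=
  ContDiffOn ℝ ∞ (fun p : EuclideanSpace ℝ (Fin n) × EuclideanSpace ℝ (Fin n) => a p.1 p.2)
      {p | p.2 ≠ 0} ∧
    ∀ j k : ℕ, ∃ C : ℝ, ∀ y ξ : EuclideanSpace ℝ (Fin n), 1 ≤ ‖ξ‖ →
      ‖iteratedFDeriv ℝ j (fun y' => iteratedFDeriv ℝ k (fun η => a y' η) ξ) y‖ ≤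
        C * (1 + ‖ξ‖) ^ (m - (k : ℝ))

/-- The total symbol
`a(y, ξ) = 2^(n-2ζ) (Γ(n/2 - ζ) / Γ(ζ - n/2)) |ξ|^(2ζ-n)` (independent of `y`). -/
def scatteringSymbol (n : ℕ) (ζ : ℂ) (_y ξ : EuclideanSpace ℝ (Fin n)) : ℂ :=
  (2 : ℂ) ^ ((n : ℂ) - 2 * ζ) *
    (Complex.Gamma ((n : ℂ) / 2 - ζ) / Complex.Gamma (ζ - (n : ℂ) / 2)) *
    ((‖ξ‖ : ℝ) : ℂ) ^ (2 * ζ - (n : ℂ))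

/-- The operator `S_ζ` with total symbol `scatteringSymbol n ζ`. -/
def scatteringOp (n : ℕ) (ζ : ℂ) (f : EuclideanSpace ℝ (Fin n) → ℂ) :
    EuclideanSpace ℝ (Fin n) → ℂ :=
  pseudoDiffOp n (scatteringSymbol n ζ) f

end

open MeasureTheory Set Filter Topology
open scoped ContDiff FourierTransform

/-! Put s = ζ - n/2, so that Re s = 0 and s ≠ 0. Euler's integral for Γ(ζ) writes the kernel as a
superposition over t of Gaussians e^(-t(x² + |y-w|²)). Convolution with each Gaussian is a Fourier
multiplier, so u is x^ζ / Γ(s) times the multiplier K = ∫₀^∞ t^(s-1) A B dt applied to f, where A =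
e^(-x²t), B = e^(-l/t), l = |ξ|²/4 (`poissonIntegral_eq_fourier`).

The expansion of K comes from AB = (A + B - 1) + (A - 1)(B - 1). The first part integrates exactly
to x^(-2s) Γ(s) + l^s Γ(-s) (`integral_cpow_mul_exp_add_exp_sub_one`); these two terms produce
x^(n-ζ) f and x^ζ S_ζ f. The second part is at most 2x(1 + l) (`norm_integral_besselRemainder_le`).
Since f̂ is rapidly decreasing, 1 + l is integrable against |f̂|, and |x^ζ| = x^(n/2) gives an error
O(x^(n/2+1)) uniform in y.

The symbol is a multiple of |ξ|^(2s), homogeneous of imaginary degree, so its derivatives are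
controlled by their values on the unit sphere. -/

/-! ### Estimates for the t-integrals on the line Re s = 0 -/

theorem one_sub_exp_neg_le_sqrt {z : ℝ} (hz : 0 ≤ z) : 1 - Real.exp (-z) ≤ √z := by
  rcases le_total z 1 with h | h
  · have h1 := Real.add_one_le_exp (-z)
    have h2 : z ≤ √z := by
      nlinarith [Real.sq_sqrt hz, Real.sqrt_nonneg z, Real.sqrt_le_one.2 h]
    linarith
  · have h1 := Real.exp_pos (-z)
    have h2 : 1 ≤ √z := Real.one_le_sqrt.2 h
    linarith

theorem norm_cpow_sub_one {s : ℂ} (hs : s.re = 0) {t : ℝ} (ht : 0 < t) :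
    ‖(t : ℂ) ^ (s - 1)‖ = t⁻¹ := by
  rw [Complex.norm_cpow_eq_rpow_re_of_pos ht, Complex.sub_re, hs, Complex.one_re, zero_sub,
    Real.rpow_neg_one]

theorem continuousOn_ofReal_cpow_Ioi (s : ℂ) :
    ContinuousOn (fun t : ℝ => (t : ℂ) ^ s) (Ioi 0) := fun t ht =>
  (Complex.continuousAt_ofReal_cpow_const t s (Or.inr (ne_of_gt ht))).continuousWithinAt

theorem integrableOn_exp_neg_mul {a : ℝ} (ha : 0 < a) :
    IntegrableOn (fun t => Real.exp (-(a * t))) (Ioi 0) := by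
  simpa using integrableOn_exp_mul_Ioi (neg_lt_zero.2 ha) 0

/-- The factor e^(-l/t) absorbs the singularity t⁻¹ = |t^(s-1)| at 0, by e^u ≥ u at u = l/t. -/
theorem inv_mul_exp_neg_div_le {l t : ℝ} (hl : 0 < l) (ht : 0 < t) :
    t⁻¹ * Real.exp (-(l / t)) ≤ l⁻¹ := by
  have h := Real.add_one_le_exp (l / t)
  rw [Real.exp_neg, ← mul_inv]
  apply inv_anti₀ hl
  have h2 : l = t * (l / t) := by field_simp
  nlinarith

theorem continuousOn_exp_neg_div (l : ℝ) :
    ContinuousOn (fun t => Real.exp (-(l / t))) (Ioi 0) :=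
  Real.continuous_exp.comp_continuousOn
    ((continuousOn_const.div continuousOn_id fun _ ht => ne_of_gt ht).neg)

theorem integrableOn_besselKernel {s : ℂ} (hs : s.re = 0) {a l : ℝ} (ha : 0 < a) (hl : 0 < l) :
    IntegrableOn (fun t : ℝ => (t : ℂ) ^ (s - 1) *
      ((Real.exp (-(a * t)) * Real.exp (-(l / t)) : ℝ) : ℂ)) (Ioi 0) := by
  refine Integrable.mono' ((integrableOn_exp_neg_mul ha).const_mul l⁻¹) ?_ ?_
  · refine ContinuousOn.aestronglyMeasurable ?_ measurableSet_Ioi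
    exact (continuousOn_ofReal_cpow_Ioi _).mul (Complex.continuous_ofReal.comp_continuousOn
      ((by fun_prop : Continuous fun t => Real.exp (-(a * t))).continuousOn.mul
        (continuousOn_exp_neg_div l)))
  · filter_upwards [ae_restrict_mem measurableSet_Ioi] with t ht
    rw [norm_mul, norm_cpow_sub_one hs ht, Complex.norm_real, Real.norm_of_nonneg (by positivity)]
    have := inv_mul_exp_neg_div_le hl ht
    calc t⁻¹ * (Real.exp (-(a * t)) * Real.exp (-(l / t)))
        = (t⁻¹ * Real.exp (-(l / t))) * Real.exp (-(a * t)) := by ring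
      _ ≤ _ := by gcongr

/-- The majorant of `t ↦ t⁻¹ (1 - e^(-x²t)) (1 - e^(-l/t))` used to estimate its integral. -/
noncomputable def besselMajorant (x l t : ℝ) : ℝ :=
  if t ≤ 1 then x * t ^ (-(1 / 2) : ℝ) else x * l * t ^ (-(3 / 2) : ℝ)

theorem integrableOn_besselMajorant (x l : ℝ) : IntegrableOn (besselMajorant x l) (Ioi 0) := by
  rw [← Ioc_union_Ioi_eq_Ioi zero_le_one]
  refine IntegrableOn.union ?_ ?_
  · have : IntegrableOn (fun t : ℝ => x * t ^ (-(1 / 2) : ℝ)) (Ioc 0 1) :=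
      ((intervalIntegrable_iff_integrableOn_Ioc_of_le zero_le_one).1
        (intervalIntegral.intervalIntegrable_rpow' (by norm_num))).const_mul x
    exact this.congr_fun (fun t ht => (if_pos ht.2).symm) measurableSet_Ioc
  · have : IntegrableOn (fun t : ℝ => x * l * t ^ (-(3 / 2) : ℝ)) (Ioi 1) :=
      (integrableOn_Ioi_rpow_of_lt (by norm_num) one_pos).const_mul (x * l)
    exact this.congr_fun (fun t ht => (if_neg (not_le.2 ht)).symm) measurableSet_Ioi

theorem integral_besselMajorant (x l : ℝ) :
    ∫ t in Ioi 0, besselMajorant x l t = 2 * x * (1 + l) := by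
  have hI := integrableOn_besselMajorant x l
  rw [← Ioc_union_Ioi_eq_Ioi (zero_le_one (α := ℝ))] at hI ⊢
  rw [setIntegral_union (Ioc_disjoint_Ioi le_rfl) measurableSet_Ioi hI.left_of_union
    hI.right_of_union,
    setIntegral_congr_fun (f := besselMajorant x l) measurableSet_Ioc
      (fun t ht => if_pos (And.right ht)),
    setIntegral_congr_fun (f := besselMajorant x l) measurableSet_Ioi
      (fun t ht => if_neg (not_le.2 ht)),
    integral_const_mul, integral_const_mul, integral_Ioi_rpow_of_lt (by norm_num) one_pos,
    ← intervalIntegral.integral_of_le zero_le_one, integral_rpow (Or.inl (by norm_num))]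
  norm_num
  ring

/-- The first factor is at most x√t, the second at most min(1, l/t). The square root is a
compromise: the bound x²t would leave x²l/t at infinity, which diverges logarithmically, whereas √t
is integrable against t⁻¹ near 0 and against l t⁻² near infinity and still yields one power of x. -/
theorem norm_cpow_mul_one_sub_exp_le {s : ℂ} (hs : s.re = 0) {x l t : ℝ} (hx : 0 < x)
    (hl : 0 < l) (ht : 0 < t) :
    ‖(t : ℂ) ^ (s - 1) *
      (((Real.exp (-(x ^ 2 * t)) - 1) * (Real.exp (-(l / t)) - 1) : ℝ) : ℂ)‖ ≤
      besselMajorant x l t := by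
  have h1 : 1 - Real.exp (-(x ^ 2 * t)) ≤ x * √t := by
    refine (one_sub_exp_neg_le_sqrt (by positivity)).trans_eq ?_
    rw [Real.sqrt_mul (by positivity), Real.sqrt_sq hx.le]
  have h2 : 1 - Real.exp (-(l / t)) ≤ 1 := by linarith [Real.exp_pos (-(l / t))]
  have h3 : 1 - Real.exp (-(l / t)) ≤ l / t := by linarith [Real.add_one_le_exp (-(l / t))]
  have h4 : 0 ≤ 1 - Real.exp (-(x ^ 2 * t)) := by
    rw [sub_nonneg, Real.exp_le_one_iff, neg_nonpos]; positivity
  have h5 : 0 ≤ 1 - Real.exp (-(l / t)) := by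
    rw [sub_nonneg, Real.exp_le_one_iff, neg_nonpos]; positivity
  have h6 : t⁻¹ * √t = t ^ (-(1 / 2) : ℝ) := by
    rw [Real.sqrt_eq_rpow, ← Real.rpow_neg_one, ← Real.rpow_add ht]; norm_num
  have h7 : t⁻¹ * √t * t⁻¹ = t ^ (-(3 / 2) : ℝ) := by
    rw [h6, ← Real.rpow_neg_one, ← Real.rpow_add ht]; norm_num
  rw [norm_mul, norm_cpow_sub_one hs ht, Complex.norm_real,
    show (Real.exp (-(x ^ 2 * t)) - 1) * (Real.exp (-(l / t)) - 1) =
      (1 - Real.exp (-(x ^ 2 * t))) * (1 - Real.exp (-(l / t))) by ring,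
    Real.norm_of_nonneg (mul_nonneg h4 h5), besselMajorant]
  split_ifs
  · rw [← h6]
    calc _ ≤ t⁻¹ * ((x * √t) * 1) := by gcongr
      _ = _ := by ring
  · rw [← h7]
    calc _ ≤ t⁻¹ * ((x * √t) * (l / t)) := by gcongr
      _ = _ := by ring

theorem integrableOn_besselRemainder {s : ℂ} (hs : s.re = 0) {x l : ℝ} (hx : 0 < x)
    (hl : 0 < l) :
    IntegrableOn (fun t : ℝ => (t : ℂ) ^ (s - 1) *
      (((Real.exp (-(x ^ 2 * t)) - 1) * (Real.exp (-(l / t)) - 1) : ℝ) : ℂ)) (Ioi 0) := by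
  refine Integrable.mono' (integrableOn_besselMajorant x l) ?_ ?_
  · refine ContinuousOn.aestronglyMeasurable ?_ measurableSet_Ioi
    exact (continuousOn_ofReal_cpow_Ioi _).mul (Complex.continuous_ofReal.comp_continuousOn
      ((by fun_prop : Continuous fun t => Real.exp (-(x ^ 2 * t)) - 1).continuousOn.mul
        ((continuousOn_exp_neg_div l).sub continuousOn_const)))
  · filter_upwards [ae_restrict_mem measurableSet_Ioi] with t ht
    exact norm_cpow_mul_one_sub_exp_le hs hx hl ht

theorem norm_integral_besselRemainder_le {s : ℂ} (hs : s.re = 0) {x l : ℝ} (hx : 0 < x)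
    (hl : 0 < l) :
    ‖∫ t in Ioi (0 : ℝ), (t : ℂ) ^ (s - 1) *
      (((Real.exp (-(x ^ 2 * t)) - 1) * (Real.exp (-(l / t)) - 1) : ℝ) : ℂ)‖ ≤
      2 * x * (1 + l) := by
  rw [← integral_besselMajorant]
  refine norm_integral_le_of_norm_le (integrableOn_besselMajorant x l) ?_
  filter_upwards [ae_restrict_mem measurableSet_Ioi] with t ht
  exact norm_cpow_mul_one_sub_exp_le hs hx hl ht

/-! ### Exact evaluation of the leading part -/

theorem integral_cpow_mul_exp_neg_mul {s : ℂ} (hs : s.re = 0) {a : ℝ} (ha : 0 < a) :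
    ∫ t in Ioi (0 : ℝ), (t : ℂ) ^ s * (Real.exp (-(a * t)) : ℂ) =
      (a : ℂ) ^ (-s - 1) * Complex.Gamma (s + 1) := by
  have h := Complex.integral_cpow_mul_exp_neg_mul_Ioi (a := s + 1) (r := a) (by simp [hs])
    (by simpa using ha)
  simp only [add_sub_cancel_right] at h
  rw [one_div, Complex.inv_cpow _ _ (by
    rw [Complex.arg_ofReal_of_nonneg ha.le]; exact Real.pi_pos.ne), ← Complex.cpow_neg] at h
  rw [show -s - 1 = -(s + 1) by ring, ← h]
  simp

theorem integrableOn_cpow_mul_exp_neg_mul {s : ℂ} (hs : s.re = 0) {a : ℝ} (ha : 0 < a) :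
    IntegrableOn (fun t : ℝ => (t : ℂ) ^ s * (Real.exp (-(a * t)) : ℂ)) (Ioi 0) := by
  refine Integrable.mono' (integrableOn_exp_neg_mul ha) ?_ ?_
  · refine ContinuousOn.aestronglyMeasurable ?_ measurableSet_Ioi
    exact (continuousOn_ofReal_cpow_Ioi _).mul (by fun_prop)
  · filter_upwards [ae_restrict_mem measurableSet_Ioi] with t ht
    rw [norm_mul, Complex.norm_cpow_eq_rpow_re_of_pos ht, hs, Complex.norm_real]
    simp

/-- The integrand after t ↦ 1/t, in the shape of the power substitution with exponent -1; it
transfers the Gamma integral to e^(-l/t). -/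
theorem cpow_inv_comp {s : ℂ} (l : ℝ) {t : ℝ} (ht : 0 < t) :
    (|(-1 : ℝ)| * t ^ ((-1 : ℝ) - 1)) • (((t ^ (-1 : ℝ) : ℝ) : ℂ) ^ (-s) *
      (Real.exp (-(l * t ^ (-1 : ℝ))) : ℂ)) =
      (t : ℂ) ^ (s - 2) * (Real.exp (-(l / t)) : ℂ) := by
  have h0 : (t : ℂ) ≠ 0 := by exact_mod_cast ht.ne'
  have h2 : ((t ^ (-2 : ℝ) : ℝ) : ℂ) = (t : ℂ) ^ (-2 : ℂ) := by
    rw [Complex.ofReal_cpow ht.le]; norm_num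
  have h3 : (((t ^ (-1 : ℝ) : ℝ) : ℂ) ^ (-s)) = (t : ℂ) ^ s := by
    rw [Real.rpow_neg_one, Complex.ofReal_inv, Complex.inv_cpow _ _ (by
      rw [Complex.arg_ofReal_of_nonneg ht.le]; exact Real.pi_pos.ne), ← Complex.cpow_neg, neg_neg]
  rw [h3, abs_neg, abs_one, one_mul, show (-1 : ℝ) - 1 = -2 by norm_num, Complex.real_smul, h2,
    ← mul_assoc, ← Complex.cpow_add _ _ h0, Real.rpow_neg_one, div_eq_mul_inv]
  congr 2
  ring

theorem integral_cpow_mul_exp_neg_div {s : ℂ} (hs : s.re = 0) {l : ℝ} (hl : 0 < l) :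
    ∫ t in Ioi (0 : ℝ), (t : ℂ) ^ (s - 2) * (Real.exp (-(l / t)) : ℂ) =
      (l : ℂ) ^ (s - 1) * Complex.Gamma (1 - s) := by
  have h := integral_comp_rpow_Ioi
    (fun t : ℝ => (t : ℂ) ^ (-s) * (Real.exp (-(l * t)) : ℂ)) (p := -1) (by norm_num)
  rw [integral_cpow_mul_exp_neg_mul (by simpa using hs) hl,
    setIntegral_congr_fun measurableSet_Ioi (fun t ht => cpow_inv_comp l ht)] at h
  rw [h]
  congr 2 <;> ring

theorem integrableOn_cpow_mul_exp_neg_div {s : ℂ} (hs : s.re = 0) {l : ℝ} (hl : 0 < l) :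
    IntegrableOn (fun t : ℝ => (t : ℂ) ^ (s - 2) * (Real.exp (-(l / t)) : ℂ)) (Ioi 0) := by
  have h := (integrableOn_Ioi_comp_rpow_iff
    (fun t : ℝ => (t : ℂ) ^ (-s) * (Real.exp (-(l * t)) : ℂ)) (p := -1) (by norm_num)).2
    (integrableOn_cpow_mul_exp_neg_mul (by simpa using hs) hl)
  exact h.congr_fun (fun t ht => cpow_inv_comp l ht) measurableSet_Ioi

/-- Since |t^s| = 1, the boundary terms of the integration by parts vanish as soon as φ does. -/
theorem tendsto_norm_cpow_mul_zero {s : ℂ} (hs : s.re = 0) {F : Filter ℝ} {φ : ℝ → ℝ}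
    (hF : ∀ᶠ t in F, 0 < t) (hφ : Tendsto φ F (𝓝 0)) :
    Tendsto (fun t : ℝ => (φ t : ℂ) * ((t : ℂ) ^ s / s)) F (𝓝 0) := by
  rw [tendsto_zero_iff_norm_tendsto_zero]
  have h : Tendsto (fun t => |φ t| * ‖s‖⁻¹) F (𝓝 0) := by
    simpa using hφ.abs.mul_const (‖s‖⁻¹)
  refine h.congr' ?_
  filter_upwards [hF] with t ht
  rw [norm_mul, norm_div, Complex.norm_cpow_eq_rpow_re_of_pos ht, hs, Complex.norm_real]
  simp

theorem tendsto_exp_neg_div_zero {l : ℝ} (hl : 0 < l) :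
    Tendsto (fun t => Real.exp (-(l / t))) (𝓝[>] 0) (𝓝 0) := by
  refine Real.tendsto_exp_neg_atTop_nhds_zero.comp ?_
  exact (tendsto_inv_nhdsGT_zero.const_mul_atTop hl).congr fun t => (div_eq_mul_inv l t).symm

/-- On Re s = 0 the two Gamma integrals do not converge absolutely on their own, but A + B - 1
vanishes at both 0 and infinity. Integrating by parts against t^s / s therefore leaves no boundary
terms, and the derivatives of A and B give convergent integrals for Γ(s + 1) and Γ(1 - s). -/
theorem integral_cpow_mul_exp_add_exp_sub_one {s : ℂ} (hs : s.re = 0) (hs0 : s ≠ 0) {a l : ℝ}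
    (ha : 0 < a) (hl : 0 < l)
    (hint : IntegrableOn (fun t : ℝ => (t : ℂ) ^ (s - 1) *
      ((Real.exp (-(a * t)) + Real.exp (-(l / t)) - 1 : ℝ) : ℂ)) (Ioi 0)) :
    ∫ t in Ioi (0 : ℝ), (t : ℂ) ^ (s - 1) *
      ((Real.exp (-(a * t)) + Real.exp (-(l / t)) - 1 : ℝ) : ℂ) =
      (a : ℂ) ^ (-s) * Complex.Gamma s + (l : ℂ) ^ s * Complex.Gamma (-s) := by
  have hA := (integrableOn_cpow_mul_exp_neg_mul hs ha).const_mul (-a / s)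
  have hL := (integrableOn_cpow_mul_exp_neg_div hs hl).const_mul (l / s)
  have heq : EqOn (fun t : ℝ => (-a / s) * ((t : ℂ) ^ s * (Real.exp (-(a * t)) : ℂ)) +
      (l / s) * ((t : ℂ) ^ (s - 2) * (Real.exp (-(l / t)) : ℂ)))
      ((fun t : ℝ => ((-a * Real.exp (-(a * t)) + l / t ^ 2 * Real.exp (-(l / t)) : ℝ) : ℂ)) *
        fun t : ℝ => (t : ℂ) ^ s / s) (Ioi 0) := by
    intro t ht
    have h0 : (t : ℂ) ≠ 0 := by exact_mod_cast (ne_of_gt ht)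
    simp only [Pi.mul_apply]
    rw [show s - 2 = s - ((2 : ℕ) : ℂ) by norm_num, Complex.cpow_sub _ _ h0, Complex.cpow_natCast]
    push_cast
    ring
  have hcomm : (fun t : ℝ => (t : ℂ) ^ (s - 1) *
      ((Real.exp (-(a * t)) + Real.exp (-(l / t)) - 1 : ℝ) : ℂ)) =
      (fun t : ℝ => ((Real.exp (-(a * t)) + Real.exp (-(l / t)) - 1 : ℝ) : ℂ)) *
      (fun t : ℝ => (t : ℂ) ^ (s - 1)) := by
    ext t; simp only [Pi.mul_apply]; ring
  have hparts := integral_Ioi_mul_deriv_eq_deriv_mul (a := 0) (a' := 0) (b' := 0)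
    (u := fun t : ℝ => ((Real.exp (-(a * t)) + Real.exp (-(l / t)) - 1 : ℝ) : ℂ))
    (v := fun t : ℝ => (t : ℂ) ^ s / s)
    (u' := fun t : ℝ => ((-a * Real.exp (-(a * t)) + l / t ^ 2 * Real.exp (-(l / t)) : ℝ) : ℂ))
    (v' := fun t : ℝ => (t : ℂ) ^ (s - 1))
    (by
      intro t ht
      have h0 : t ≠ 0 := ne_of_gt ht
      refine HasDerivAt.ofReal_comp ?_
      have h1 : HasDerivAt (fun t => Real.exp (-(a * t))) (-a * Real.exp (-(a * t))) t := by
        simpa [mul_comm] using ((hasDerivAt_id t).const_mul a).neg.exp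
      have h2 : HasDerivAt (fun t => Real.exp (-(l / t))) (l / t ^ 2 * Real.exp (-(l / t))) t := by
        have h3 : HasDerivAt (fun t => -(l / t)) (l / t ^ 2) t := by
          convert! ((hasDerivAt_inv h0).const_mul l).neg using 1
          ring
        simpa [mul_comm] using h3.exp
      exact (h1.add h2).sub_const 1)
    (by
      intro t ht
      have h := hasDerivAt_ofReal_cpow_const' (x := t) (r := s - 1) (ne_of_gt ht)
        (by intro h; apply hs0; linear_combination h)
      simpa using h)
    (hcomm ▸ hint)
    (IntegrableOn.congr_fun (hA.add hL) heq measurableSet_Ioi)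
    (tendsto_norm_cpow_mul_zero hs (eventually_mem_nhdsWithin) (by
      have h1 : Tendsto (fun t => Real.exp (-(a * t))) (𝓝[>] 0) (𝓝 1) := by
        have : Continuous fun t => Real.exp (-(a * t)) := by fun_prop
        simpa using (this.tendsto 0).mono_left nhdsWithin_le_nhds
      simpa using (h1.add (tendsto_exp_neg_div_zero hl)).sub_const 1))
    (tendsto_norm_cpow_mul_zero hs (eventually_gt_atTop 0) (by
      have h1 : Tendsto (fun t => Real.exp (-(a * t))) atTop (𝓝 0) :=
        Real.tendsto_exp_neg_atTop_nhds_zero.comp (tendsto_id.const_mul_atTop ha)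
      have h2 : Tendsto (fun t => Real.exp (-(l / t))) atTop (𝓝 1) := by
        have : Tendsto (fun t => -(l / t)) atTop (𝓝 0) := by
          simpa using (tendsto_const_nhds.div_atTop (tendsto_id (α := ℝ))).neg
        simpa [Function.comp_def] using (Real.continuous_exp.tendsto 0).comp this
      simpa using (h1.add h2).sub_const 1))
  have hval : ∫ t in Ioi (0 : ℝ),
      ((-a * Real.exp (-(a * t)) + l / t ^ 2 * Real.exp (-(l / t)) : ℝ) : ℂ) *
        ((t : ℂ) ^ s / s) =
      (-a / s) * ((a : ℂ) ^ (-s - 1) * Complex.Gamma (s + 1)) +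
        (l / s) * ((l : ℂ) ^ (s - 1) * Complex.Gamma (1 - s)) := by
    rw [← integral_cpow_mul_exp_neg_mul hs ha, ← integral_cpow_mul_exp_neg_div hs hl,
      ← integral_const_mul, ← integral_const_mul, ← integral_add hA hL]
    exact (setIntegral_congr_fun measurableSet_Ioi heq).symm
  have ha0 : (a : ℂ) ≠ 0 := by exact_mod_cast ha.ne'
  have hl0 : (l : ℂ) ≠ 0 := by exact_mod_cast hl.ne'
  have hG : Complex.Gamma (1 - s) = -s * Complex.Gamma (-s) := by
    rw [← Complex.Gamma_add_one _ (neg_ne_zero.2 hs0)]; congr 1; ring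
  rw [hcomm]
  refine hparts.trans ?_
  rw [ hval, Complex.Gamma_add_one s hs0, hG, Complex.cpow_sub _ _ ha0,
    Complex.cpow_sub _ _ hl0, Complex.cpow_one, Complex.cpow_one]
  field_simp
  ring

theorem norm_integral_besselKernel_sub_le {s : ℂ} (hs : s.re = 0) (hs0 : s ≠ 0) {x l : ℝ}
    (hx : 0 < x) (hl : 0 < l) :
    ‖(∫ t in Ioi (0 : ℝ), (t : ℂ) ^ (s - 1) *
      ((Real.exp (-(x ^ 2 * t)) * Real.exp (-(l / t)) : ℝ) : ℂ)) -
      (((x ^ 2 : ℝ) : ℂ) ^ (-s) * Complex.Gamma s + (l : ℂ) ^ s * Complex.Gamma (-s))‖ ≤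
      2 * x * (1 + l) := by
  have hx2 : 0 < x ^ 2 := by positivity
  have hK := integrableOn_besselKernel hs hx2 hl
  have hJ := integrableOn_besselRemainder hs hx hl
  -- A + B - 1 = AB - (A - 1)(B - 1); this also gives the integrability of the left side.
  have heq : (fun t : ℝ => (t : ℂ) ^ (s - 1) *
      ((Real.exp (-(x ^ 2 * t)) + Real.exp (-(l / t)) - 1 : ℝ) : ℂ)) = fun t : ℝ =>
      (t : ℂ) ^ (s - 1) * ((Real.exp (-(x ^ 2 * t)) * Real.exp (-(l / t)) : ℝ) : ℂ) -
      (t : ℂ) ^ (s - 1) *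
        (((Real.exp (-(x ^ 2 * t)) - 1) * (Real.exp (-(l / t)) - 1) : ℝ) : ℂ) := by
    ext t; push_cast; ring
  rw [← integral_cpow_mul_exp_add_exp_sub_one hs hs0 hx2 hl (heq ▸ hK.sub hJ), heq,
    integral_sub hK hJ, sub_sub_cancel]
  exact norm_integral_besselRemainder_le hs hx hl

/-! ### Fourier transform in the e^(-iw·ξ) normalization -/

theorem fourierHat_eq_fourier (n : ℕ) (f : EuclideanSpace ℝ (Fin n) → ℂ)
    (ξ : EuclideanSpace ℝ (Fin n)) : fourierHat n f ξ = 𝓕 f ((2 * Real.pi)⁻¹ • ξ) := by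
  rw [fourierHat, Real.fourier_eq']
  congr 1 with w
  rw [inner_smul_right, smul_eq_mul]
  congr 2
  have := Real.pi_pos.ne'
  rw [show -2 * Real.pi * ((2 * Real.pi)⁻¹ * inner ℝ w ξ) = - inner ℝ w ξ by field_simp]
  push_cast
  ring

theorem exists_schwartzMap_fourierHat_eq {n : ℕ} {f : EuclideanSpace ℝ (Fin n) → ℂ}
    (hf : ContDiff ℝ ∞ f) (hc : HasCompactSupport f) :
    ∃ g : SchwartzMap (EuclideanSpace ℝ (Fin n)) ℂ,
      fourierHat n f = fun ξ => g ((2 * Real.pi)⁻¹ • ξ) :=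
  ⟨𝓕 (hc.toSchwartzMap hf), funext fun ξ => by
    rw [fourierHat_eq_fourier, SchwartzMap.fourier_coe]; rfl⟩

section SmoothCompactSupport

variable {n : ℕ} {f : EuclideanSpace ℝ (Fin n) → ℂ}

theorem continuous_fourierHat (hf : ContDiff ℝ ∞ f) (hc : HasCompactSupport f) :
    Continuous (fourierHat n f) := by
  obtain ⟨g, hg⟩ := exists_schwartzMap_fourierHat_eq hf hc
  rw [hg]
  exact g.continuous.comp (continuous_const_smul _)

theorem exists_norm_fourierHat_le (hf : ContDiff ℝ ∞ f) (hc : HasCompactSupport f) :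
    ∃ M : ℝ, ∀ ξ, ‖fourierHat n f ξ‖ ≤ M := by
  obtain ⟨g, hg⟩ := exists_schwartzMap_fourierHat_eq hf hc
  rw [hg]
  exact ⟨_, fun ξ => SchwartzMap.norm_le_seminorm ℝ g _⟩

theorem integrable_fourierHat (hf : ContDiff ℝ ∞ f) (hc : HasCompactSupport f) :
    Integrable (fourierHat n f) := by
  obtain ⟨g, hg⟩ := exists_schwartzMap_fourierHat_eq hf hc
  rw [hg]
  exact g.integrable.comp_smul (by positivity)

theorem integrable_sq_norm_mul_norm_fourierHat (hf : ContDiff ℝ ∞ f) (hc : HasCompactSupport f) :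
    Integrable fun ξ => ‖ξ‖ ^ 2 * ‖fourierHat n f ξ‖ := by
  obtain ⟨g, hg⟩ := exists_schwartzMap_fourierHat_eq hf hc
  rw [hg]
  have h := ((g.integrable_pow_mul volume 2).comp_smul
    (R := (2 * Real.pi)⁻¹) (by positivity)).const_mul ((2 * Real.pi) ^ 2)
  refine h.congr (Eventually.of_forall fun ξ => ?_)
  have := Real.pi_pos
  beta_reduce
  rw [norm_smul, Real.norm_of_nonneg (by positivity)]
  field_simp

theorem fourierHat_inversion (hf : ContDiff ℝ ∞ f) (hc : HasCompactSupport f)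
    (y : EuclideanSpace ℝ (Fin n)) :
    ((2 * (Real.pi : ℂ)) ^ n)⁻¹ *
      ∫ ξ, Complex.exp (Complex.I * ((inner ℝ y ξ : ℝ) : ℂ)) * fourierHat n f ξ = f y := by
  have hinv : 𝓕⁻ (𝓕 f) = f :=
    hf.continuous.fourierInv_fourier_eq (hc.toSchwartzMap hf).integrable
      (𝓕 (hc.toSchwartzMap hf)).integrable
  have h := congrFun hinv y
  rw [Real.fourierInv_eq'] at h
  have hs := Measure.integral_comp_smul_of_nonneg volume
    (fun v : EuclideanSpace ℝ (Fin n) =>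
      Complex.exp (((2 * Real.pi * inner ℝ v y : ℝ) : ℂ) * Complex.I) • 𝓕 f v)
    (2 * Real.pi)⁻¹ (hR := by positivity)
  rw [h, finrank_euclideanSpace_fin] at hs
  have h1 : ∀ ξ : EuclideanSpace ℝ (Fin n),
      Complex.exp (((2 * Real.pi * inner ℝ ((2 * Real.pi)⁻¹ • ξ) y : ℝ) : ℂ) * Complex.I) •
        𝓕 f ((2 * Real.pi)⁻¹ • ξ) =
      Complex.exp (Complex.I * ((inner ℝ y ξ : ℝ) : ℂ)) * fourierHat n f ξ := by
    intro ξ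
    have := Real.pi_pos.ne'
    rw [fourierHat_eq_fourier, smul_eq_mul, real_inner_smul_left, real_inner_comm,
      show 2 * Real.pi * ((2 * Real.pi)⁻¹ * inner ℝ y ξ) = inner ℝ y ξ by field_simp,
      mul_comm Complex.I]
  simp only [h1] at hs
  have : (Real.pi : ℂ) ≠ 0 := by exact_mod_cast Real.pi_pos.ne'
  rw [hs, Complex.real_smul, ← mul_assoc, inv_pow, inv_inv]
  push_cast
  rw [inv_mul_cancel₀ (pow_ne_zero _ (mul_ne_zero two_ne_zero this)), one_mul]

/-- The Gaussian in y - w is itself the Fourier integral of a Gaussian in ξ; inserting this and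
exchanging the integrals by Fubini produces f̂. -/
theorem gaussian_convolution_eq (hf : ContDiff ℝ ∞ f) (hc : HasCompactSupport f)
    (y : EuclideanSpace ℝ (Fin n)) {t : ℝ} (ht : 0 < t) :
    ∫ w, (Real.exp (-(t * ‖y - w‖ ^ 2)) : ℂ) * f w =
      ((2 * (Real.pi : ℂ)) ^ n)⁻¹ * (((Real.pi / t) ^ ((n : ℝ) / 2) : ℝ) : ℂ) *
      ∫ ξ, (Real.exp (-(‖ξ‖ ^ 2 / 4 / t)) : ℂ) *
        (Complex.exp (Complex.I * ((inner ℝ y ξ : ℝ) : ℂ)) * fourierHat n f ξ) := by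
  have hfi : Integrable f := (hc.toSchwartzMap hf).integrable
  have hb : 0 < ((1 / (4 * t) : ℝ) : ℂ).re := by rw [Complex.ofReal_re]; positivity
  have hexp : ∀ ξ w : EuclideanSpace ℝ (Fin n),
      Complex.exp (-((1 / (4 * t) : ℝ) : ℂ) * ‖ξ‖ ^ 2 + Complex.I * ((inner ℝ (y - w) ξ : ℝ) : ℂ)) =
      (Real.exp (-(‖ξ‖ ^ 2 / 4 / t)) : ℂ) *
        (Complex.exp (Complex.I * ((inner ℝ y ξ : ℝ) : ℂ)) *
          Complex.exp (-(Complex.I * ((inner ℝ w ξ : ℝ) : ℂ)))) := by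
    intro ξ w
    rw [Complex.ofReal_exp, ← Complex.exp_add, ← Complex.exp_add, inner_sub_left]
    congr 1
    push_cast
    field_simp
    ring
  have hint : Integrable (Function.uncurry fun ξ w : EuclideanSpace ℝ (Fin n) =>
      Complex.exp (-((1 / (4 * t) : ℝ) : ℂ) * ‖ξ‖ ^ 2 + Complex.I * ((inner ℝ (y - w) ξ : ℝ) : ℂ)) *
        f w) (volume.prod volume) := by
    have h0 := ((GaussianFourier.integrable_cexp_neg_mul_sq_norm_add hb 0
      (0 : EuclideanSpace ℝ (Fin n))).mul_prod hfi)
    refine h0.mono ?_ (Eventually.of_forall fun p => ?_)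
    · have := hf.continuous
      refine Continuous.aestronglyMeasurable ?_
      simp only [Function.uncurry_def]
      fun_prop
    · simp only [Function.uncurry_def, norm_mul, Complex.norm_exp]
      simp [← Complex.ofReal_pow]
  have hinner : ∀ w : EuclideanSpace ℝ (Fin n), ∫ ξ : EuclideanSpace ℝ (Fin n),
      Complex.exp (-((1 / (4 * t) : ℝ) : ℂ) * ‖ξ‖ ^ 2 +
        Complex.I * ((inner ℝ (y - w) ξ : ℝ) : ℂ)) * f w =
      (((4 * Real.pi * t) ^ ((n : ℝ) / 2) : ℝ) : ℂ) *
        ((Real.exp (-(t * ‖y - w‖ ^ 2)) : ℂ) * f w) := by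
    intro w
    rw [integral_mul_const, GaussianFourier.integral_cexp_neg_mul_sq_norm_add hb,
      finrank_euclideanSpace_fin, Complex.ofReal_cpow (by positivity), Complex.I_sq, ← mul_assoc,
      Complex.ofReal_exp]
    have : (t : ℂ) ≠ 0 := by exact_mod_cast ht.ne'
    congr 3
    · push_cast; field_simp
    · push_cast; rfl
    · push_cast; field_simp
  have hswap := integral_integral_swap hint
  simp only [hinner] at hswap
  rw [integral_const_mul] at hswap
  have hleft : ∀ ξ : EuclideanSpace ℝ (Fin n), ∫ w : EuclideanSpace ℝ (Fin n),
      Complex.exp (-((1 / (4 * t) : ℝ) : ℂ) * ‖ξ‖ ^ 2 +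
        Complex.I * ((inner ℝ (y - w) ξ : ℝ) : ℂ)) * f w =
      (Real.exp (-(‖ξ‖ ^ 2 / 4 / t)) : ℂ) *
        (Complex.exp (Complex.I * ((inner ℝ y ξ : ℝ) : ℂ)) * fourierHat n f ξ) := by
    intro ξ
    rw [fourierHat, ← integral_const_mul, ← integral_const_mul]
    congr 1 with w
    rw [hexp]
    ring
  simp only [hleft] at hswap
  rw [hswap, ← mul_assoc]
  -- The normalizing factors match because (π/t)(4πt) = (2π)².
  have hc1 : (Real.pi / t) ^ ((n : ℝ) / 2) * (4 * Real.pi * t) ^ ((n : ℝ) / 2) =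
      (2 * Real.pi) ^ n := by
    rw [← Real.mul_rpow (by positivity) (by positivity),
      show Real.pi / t * (4 * Real.pi * t) = (2 * Real.pi) ^ 2 by field_simp; ring,
      ← Real.rpow_natCast (2 * Real.pi) 2, ← Real.rpow_mul (by positivity), Nat.cast_ofNat,
      mul_div_cancel₀ _ (two_ne_zero), Real.rpow_natCast]
  have hc2 : ((2 * (Real.pi : ℂ)) ^ n)⁻¹ * (((Real.pi / t) ^ ((n : ℝ) / 2) : ℝ) : ℂ) *
      (((4 * Real.pi * t) ^ ((n : ℝ) / 2) : ℝ) : ℂ) = 1 := by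
    rw [mul_assoc, ← Complex.ofReal_mul, hc1]
    push_cast
    have : (Real.pi : ℂ) ≠ 0 := by exact_mod_cast Real.pi_pos.ne'
    exact inv_mul_cancel₀ (pow_ne_zero _ (mul_ne_zero two_ne_zero this))
  rw [hc2, one_mul]

end SmoothCompactSupport

/-! ### The Poisson integral as a Fourier multiplier -/

/-- The integral `∫₀^∞ t^(s-1) e^(-x²t - l/t) dt`, a form of the Macdonald function. -/
noncomputable def macdonaldIntegral (s : ℂ) (x l : ℝ) : ℂ :=
  ∫ t in Ioi (0 : ℝ), (t : ℂ) ^ (s - 1) *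
    ((Real.exp (-(x ^ 2 * t)) * Real.exp (-(l / t)) : ℝ) : ℂ)

theorem integrableOn_rpow_mul_exp_neg {a b : ℝ} (ha : -1 < a) (hb : 0 < b) :
    IntegrableOn (fun t : ℝ => t ^ a * Real.exp (-(b * t))) (Ioi 0) := by
  have h := integrableOn_rpow_mul_exp_neg_mul_rpow ha one_pos hb
  simpa using h

theorem div_cpow_eq_integral {ζ : ℂ} (hζ : 0 < ζ.re) {x D : ℝ} (hx : 0 < x) (hD : 0 < D) :
    ((x / D : ℝ) : ℂ) ^ ζ = (x : ℂ) ^ ζ * (Complex.Gamma ζ)⁻¹ *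
      ∫ t in Ioi (0 : ℝ), (t : ℂ) ^ (ζ - 1) * (Real.exp (-(D * t)) : ℂ) := by
  have h := Complex.integral_cpow_mul_exp_neg_mul_Ioi (a := ζ) (r := D) hζ (by simpa using hD)
  have hG : Complex.Gamma ζ ≠ 0 := Complex.Gamma_ne_zero_of_re_pos hζ
  have h2 : ∫ t in Ioi (0 : ℝ), (t : ℂ) ^ (ζ - 1) * (Real.exp (-(D * t)) : ℂ) =
      (1 / (D : ℂ)) ^ ζ * Complex.Gamma ζ := by
    rw [← h]; simp
  rw [h2, div_eq_mul_one_div, Complex.ofReal_mul,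
    Complex.mul_cpow_ofReal_nonneg hx.le (by positivity)]
  push_cast
  field_simp

section Poisson

variable {n : ℕ} {ζ : ℂ} {f : EuclideanSpace ℝ (Fin n) → ℂ}

/-- Dropping |y-w|² from the exponent leaves the product majorant |f(w)| t^(n/2-1) e^(-x²t),
integrable at 0 because n ≥ 1. -/
theorem integrable_poisson_gamma (hn : 1 ≤ n) (hre : ζ.re = (n : ℝ) / 2) (hf : ContDiff ℝ ∞ f)
    (hc : HasCompactSupport f) {x : ℝ} (hx : 0 < x) (y : EuclideanSpace ℝ (Fin n)) :
    Integrable (Function.uncurry fun (w : EuclideanSpace ℝ (Fin n)) (t : ℝ) =>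
      (t : ℂ) ^ (ζ - 1) * (Real.exp (-((x ^ 2 + ‖y - w‖ ^ 2) * t)) : ℂ) * f w)
      (volume.prod (volume.restrict (Ioi 0))) := by
  have hfi : Integrable f := (hc.toSchwartzMap hf).integrable
  have hn' : (1 : ℝ) ≤ n := by exact_mod_cast hn
  have h1 : IntegrableOn (fun t : ℝ => t ^ ((n : ℝ) / 2 - 1) * Real.exp (-(x ^ 2 * t))) (Ioi 0) :=
    integrableOn_rpow_mul_exp_neg (by linarith) (by positivity)
  refine (hfi.norm.mul_prod h1).mono' ?_ ?_
  · have := hf.continuous.measurable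
    refine Measurable.aestronglyMeasurable ?_
    simp only [Function.uncurry_def]
    fun_prop
  · filter_upwards [Measure.quasiMeasurePreserving_snd.ae (ae_restrict_mem measurableSet_Ioi)]
      with p hp
    have hp : 0 < p.2 := hp
    simp only [Function.uncurry_def, norm_mul, Complex.norm_real]
    rw [Complex.norm_cpow_eq_rpow_re_of_pos hp, Complex.sub_re, hre, Complex.one_re, mul_comm,
      Real.norm_of_nonneg (Real.exp_nonneg _)]
    gcongr
    nlinarith [sq_nonneg ‖y - p.1‖]

/-- Here |t^(s-1)| = t⁻¹ is not integrable at 0, so the ξ-integral is taken first: with f̂ merely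
bounded, the Gaussian mass (4πt)^(n/2) restores the integrable power t^(n/2-1). -/
theorem integrable_poisson_fourier (hn : 1 ≤ n) {s : ℂ} (hs : s.re = 0) (hf : ContDiff ℝ ∞ f)
    (hc : HasCompactSupport f) {x : ℝ} (hx : 0 < x) (y : EuclideanSpace ℝ (Fin n)) :
    Integrable (Function.uncurry fun (t : ℝ) (ξ : EuclideanSpace ℝ (Fin n)) =>
      (t : ℂ) ^ (s - 1) *
        ((Real.exp (-(x ^ 2 * t)) * Real.exp (-(‖ξ‖ ^ 2 / 4 / t)) : ℝ) : ℂ) *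
        (Complex.exp (Complex.I * ((inner ℝ y ξ : ℝ) : ℂ)) * fourierHat n f ξ))
      ((volume.restrict (Ioi 0)).prod volume) := by
  have hn' : (1 : ℝ) ≤ n := by exact_mod_cast hn
  obtain ⟨M, hM⟩ := exists_norm_fourierHat_le hf hc
  have hM0 : 0 ≤ M := (norm_nonneg _).trans (hM 0)
  have hcont := continuous_fourierHat hf hc
  have hmeas : Measurable (Function.uncurry fun (t : ℝ) (ξ : EuclideanSpace ℝ (Fin n)) =>
      (t : ℂ) ^ (s - 1) *
        ((Real.exp (-(x ^ 2 * t)) * Real.exp (-(‖ξ‖ ^ 2 / 4 / t)) : ℝ) : ℂ) *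
        (Complex.exp (Complex.I * ((inner ℝ y ξ : ℝ) : ℂ)) * fourierHat n f ξ)) := by
    have := hcont.measurable
    have h2 : Measurable fun ξ : EuclideanSpace ℝ (Fin n) => (inner ℝ y ξ : ℝ) :=
      (by fun_prop : Continuous _).measurable
    simp only [Function.uncurry_def]
    fun_prop
  have hnorm : ∀ t : ℝ, 0 < t → ∀ ξ : EuclideanSpace ℝ (Fin n), ‖(t : ℂ) ^ (s - 1) *
      ((Real.exp (-(x ^ 2 * t)) * Real.exp (-(‖ξ‖ ^ 2 / 4 / t)) : ℝ) : ℂ) *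
      (Complex.exp (Complex.I * ((inner ℝ y ξ : ℝ) : ℂ)) * fourierHat n f ξ)‖ ≤
      t⁻¹ * Real.exp (-(x ^ 2 * t)) * M * Real.exp (-(1 / (4 * t)) * ‖ξ‖ ^ 2) := by
    intro t ht ξ
    rw [norm_mul, norm_mul, norm_mul, norm_cpow_sub_one hs ht, Complex.norm_real,
      Real.norm_of_nonneg (by positivity), mul_comm Complex.I, Complex.norm_exp_ofReal_mul_I,
      one_mul, show -(‖ξ‖ ^ 2 / 4 / t) = -(1 / (4 * t)) * ‖ξ‖ ^ 2 by field_simp]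
    calc _ ≤ t⁻¹ * (Real.exp (-(x ^ 2 * t)) * Real.exp (-(1 / (4 * t)) * ‖ξ‖ ^ 2)) * M := by
          gcongr; exact hM ξ
      _ = _ := by ring
  have hgauss : ∀ t : ℝ, 0 < t → Integrable fun ξ : EuclideanSpace ℝ (Fin n) =>
      Real.exp (-(1 / (4 * t)) * ‖ξ‖ ^ 2) := by
    intro t ht
    have hb : 0 < ((1 / (4 * t) : ℝ) : ℂ).re := by rw [Complex.ofReal_re]; positivity
    have h := (GaussianFourier.integrable_cexp_neg_mul_sq_norm_add hb 0
      (0 : EuclideanSpace ℝ (Fin n))).norm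
    simpa [Complex.norm_exp, ← Complex.ofReal_pow] using h
  rw [integrable_prod_iff hmeas.aestronglyMeasurable]
  constructor
  · filter_upwards [ae_restrict_mem measurableSet_Ioi] with t ht
    exact ((hgauss t ht).const_mul _).mono' (hmeas.comp measurable_prodMk_left).aestronglyMeasurable
      (Eventually.of_forall (hnorm t ht))
  · have h1 : IntegrableOn (fun t : ℝ => M * (4 * Real.pi) ^ ((n : ℝ) / 2) *
        (t ^ ((n : ℝ) / 2 - 1) * Real.exp (-(x ^ 2 * t)))) (Ioi 0) :=
      (integrableOn_rpow_mul_exp_neg (by linarith) (by positivity)).const_mul _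
    refine h1.mono' hmeas.norm.aestronglyMeasurable.integral_prod_right' ?_
    filter_upwards [ae_restrict_mem measurableSet_Ioi] with t ht
    have ht : 0 < t := ht
    rw [Real.norm_of_nonneg (integral_nonneg fun _ => norm_nonneg _)]
    refine (integral_mono_of_nonneg (Eventually.of_forall fun _ => norm_nonneg _)
      ((hgauss t ht).const_mul _) (Eventually.of_forall (hnorm t ht))).trans_eq ?_
    rw [integral_const_mul, GaussianFourier.integral_rexp_neg_mul_sq_norm (by positivity),
      finrank_euclideanSpace_fin, show Real.pi / (1 / (4 * t)) = 4 * Real.pi * t by field_simp,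
      Real.mul_rpow (by positivity) ht.le, Real.rpow_sub_one ht.ne']
    field_simp

theorem integrable_exp_mul_fourierHat_mul_macdonald (hn : 1 ≤ n) {s : ℂ} (hs : s.re = 0)
    (hf : ContDiff ℝ ∞ f) (hc : HasCompactSupport f) {x : ℝ} (hx : 0 < x)
    (y : EuclideanSpace ℝ (Fin n)) :
    Integrable fun ξ : EuclideanSpace ℝ (Fin n) => macdonaldIntegral s x (‖ξ‖ ^ 2 / 4) *
      (Complex.exp (Complex.I * ((inner ℝ y ξ : ℝ) : ℂ)) * fourierHat n f ξ) := by
  have h := (integrable_poisson_fourier hn hs hf hc hx y).integral_prod_right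
  simpa only [Function.uncurry_apply_pair, integral_mul_const, macdonaldIntegral] using h

/-- With 2ζ - n = 2s and Γ(s + 1) = s Γ(s), the normalization of `cZeta` cancels everything except
1/Γ(s). -/
theorem poisson_constant_eq (hre : ζ.re = (n : ℝ) / 2) (hn : 1 ≤ n) (hne : ζ ≠ (n : ℂ) / 2) :
    (2 : ℂ) ^ (2 * ζ) * (2 * ζ - (n : ℂ)) * cZeta n ζ * (Complex.Gamma ζ)⁻¹ *
      ((Real.pi ^ ((n : ℝ) / 2) : ℝ) : ℂ) = (Complex.Gamma (ζ - (n : ℂ) / 2))⁻¹ := by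
  have hn' : (1 : ℝ) ≤ n := by exact_mod_cast hn
  have hG : Complex.Gamma ζ ≠ 0 := Complex.Gamma_ne_zero_of_re_pos (by rw [hre]; linarith)
  have hs0 : ζ - (n : ℂ) / 2 ≠ 0 := sub_ne_zero.2 hne
  have hpi : (Real.pi : ℂ) ≠ 0 := by exact_mod_cast Real.pi_pos.ne'
  have hpow : (2 : ℂ) ^ (2 * ζ) * (2 : ℂ) ^ (-2 * ζ - 1) = 1 / 2 := by
    rw [← Complex.cpow_add _ _ two_ne_zero, show 2 * ζ + (-2 * ζ - 1) = -1 by ring,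
      Complex.cpow_neg_one, one_div]
  have hpow2 : (Real.pi : ℂ) ^ (-(n : ℂ) / 2) * ((Real.pi ^ ((n : ℝ) / 2) : ℝ) : ℂ) = 1 := by
    rw [Complex.ofReal_cpow Real.pi_pos.le, ← Complex.cpow_add _ _ hpi]
    push_cast
    rw [show -(n : ℂ) / 2 + n / 2 = 0 by ring, Complex.cpow_zero]
  rw [cZeta, Complex.Gamma_add_one _ hs0]
  calc _ = ((2 : ℂ) ^ (2 * ζ) * (2 : ℂ) ^ (-2 * ζ - 1)) *
        ((Real.pi : ℂ) ^ (-(n : ℂ) / 2) * ((Real.pi ^ ((n : ℝ) / 2) : ℝ) : ℂ)) *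
        (2 * (ζ - (n : ℂ) / 2)) * (Complex.Gamma ζ * (Complex.Gamma ζ)⁻¹) *
        ((ζ - (n : ℂ) / 2) * Complex.Gamma (ζ - (n : ℂ) / 2))⁻¹ := by ring
    _ = _ := by
      rw [hpow, hpow2, mul_inv_cancel₀ hG, mul_inv]
      linear_combination (Complex.Gamma (ζ - (n : ℂ) / 2))⁻¹ * mul_inv_cancel₀ hs0

theorem poissonIntegral_eq_fourier (hn : 1 ≤ n) (hre : ζ.re = (n : ℝ) / 2)
    (hne : ζ ≠ (n : ℂ) / 2) (hf : ContDiff ℝ ∞ f) (hc : HasCompactSupport f) {x : ℝ}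
    (hx : 0 < x) (y : EuclideanSpace ℝ (Fin n)) :
    poissonIntegral n ζ f x y = (x : ℂ) ^ ζ * (Complex.Gamma (ζ - (n : ℂ) / 2))⁻¹ *
      ((2 * (Real.pi : ℂ)) ^ n)⁻¹ *
      ∫ ξ : EuclideanSpace ℝ (Fin n),
        macdonaldIntegral (ζ - (n : ℂ) / 2) x (‖ξ‖ ^ 2 / 4) *
        (Complex.exp (Complex.I * ((inner ℝ y ξ : ℝ) : ℂ)) * fourierHat n f ξ) := by
  have hn' : (1 : ℝ) ≤ n := by exact_mod_cast hn
  have hs : (ζ - (n : ℂ) / 2).re = 0 := by simp [hre]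
  have h1 : ∀ w : EuclideanSpace ℝ (Fin n), eigenKernel n ζ x y w * f w =
      cZeta n ζ * ((x : ℂ) ^ ζ * (Complex.Gamma ζ)⁻¹) * ∫ t in Ioi (0 : ℝ),
        (t : ℂ) ^ (ζ - 1) * (Real.exp (-((x ^ 2 + ‖y - w‖ ^ 2) * t)) : ℂ) * f w := by
    intro w
    rw [eigenKernel, div_cpow_eq_integral (by rw [hre]; linarith) hx (by positivity),
      integral_mul_const]
    ring
  have h2 : ∀ t ∈ Ioi (0 : ℝ), ∫ w : EuclideanSpace ℝ (Fin n),
      (t : ℂ) ^ (ζ - 1) * (Real.exp (-((x ^ 2 + ‖y - w‖ ^ 2) * t)) : ℂ) * f w =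
      ((2 * (Real.pi : ℂ)) ^ n)⁻¹ * ((Real.pi ^ ((n : ℝ) / 2) : ℝ) : ℂ) *
      ∫ ξ : EuclideanSpace ℝ (Fin n), (t : ℂ) ^ (ζ - (n : ℂ) / 2 - 1) *
        ((Real.exp (-(x ^ 2 * t)) * Real.exp (-(‖ξ‖ ^ 2 / 4 / t)) : ℝ) : ℂ) *
        (Complex.exp (Complex.I * ((inner ℝ y ξ : ℝ) : ℂ)) * fourierHat n f ξ) := by
    intro t ht
    have ht : 0 < t := ht
    have h0 : (t : ℂ) ≠ 0 := by exact_mod_cast ht.ne'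
    have hsplit : ∀ w : EuclideanSpace ℝ (Fin n),
        (t : ℂ) ^ (ζ - 1) * (Real.exp (-((x ^ 2 + ‖y - w‖ ^ 2) * t)) : ℂ) * f w =
        (t : ℂ) ^ (ζ - 1) * (Real.exp (-(x ^ 2 * t)) : ℂ) *
          ((Real.exp (-(t * ‖y - w‖ ^ 2)) : ℂ) * f w) := by
      intro w
      rw [show -((x ^ 2 + ‖y - w‖ ^ 2) * t) = -(x ^ 2 * t) + -(t * ‖y - w‖ ^ 2) by ring,
        Real.exp_add]
      push_cast
      ring
    -- The factor t^(-n/2) from the Gaussian shifts the exponent from ζ - 1 to s - 1.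
    have hpow : (t : ℂ) ^ (ζ - 1) * (((Real.pi / t) ^ ((n : ℝ) / 2) : ℝ) : ℂ) =
        ((Real.pi ^ ((n : ℝ) / 2) : ℝ) : ℂ) * (t : ℂ) ^ (ζ - (n : ℂ) / 2 - 1) := by
      rw [Real.div_rpow Real.pi_pos.le ht.le, Complex.ofReal_div, Complex.ofReal_cpow ht.le,
        show ζ - (n : ℂ) / 2 - 1 = (ζ - 1) - (n : ℂ) / 2 by ring,
        Complex.cpow_sub (ζ - 1) _ h0]
      push_cast
      ring
    simp only [hsplit]
    rw [integral_const_mul, gaussian_convolution_eq hf hc y ht]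
    have hr : ∀ ξ : EuclideanSpace ℝ (Fin n), (t : ℂ) ^ (ζ - (n : ℂ) / 2 - 1) *
        ((Real.exp (-(x ^ 2 * t)) * Real.exp (-(‖ξ‖ ^ 2 / 4 / t)) : ℝ) : ℂ) *
        (Complex.exp (Complex.I * ((inner ℝ y ξ : ℝ) : ℂ)) * fourierHat n f ξ) =
        (t : ℂ) ^ (ζ - (n : ℂ) / 2 - 1) * (Real.exp (-(x ^ 2 * t)) : ℂ) *
        ((Real.exp (-(‖ξ‖ ^ 2 / 4 / t)) : ℂ) *
        (Complex.exp (Complex.I * ((inner ℝ y ξ : ℝ) : ℂ)) * fourierHat n f ξ)) := by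
      intro ξ; push_cast; ring
    simp only [hr]
    rw [integral_const_mul]
    linear_combination ((2 * (Real.pi : ℂ)) ^ n)⁻¹ * (Real.exp (-(x ^ 2 * t)) : ℂ) *
      (∫ ξ, (Real.exp (-(‖ξ‖ ^ 2 / 4 / t)) : ℂ) *
        (Complex.exp (Complex.I * ((inner ℝ y ξ : ℝ) : ℂ)) * fourierHat n f ξ)) * hpow
  rw [poissonIntegral]
  simp only [h1]
  rw [integral_const_mul, integral_integral_swap (integrable_poisson_gamma hn hre hf hc hx y),
    setIntegral_congr_fun measurableSet_Ioi h2, integral_const_mul,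
    integral_integral_swap (integrable_poisson_fourier hn hs hf hc hx y),
    ← poisson_constant_eq hre hn hne]
  simp only [integral_mul_const, macdonaldIntegral]
  ring

end Poisson

/-! ### Symbol estimates -/

theorem contDiffAt_norm_cpow {E : Type*} [NormedAddCommGroup E] [InnerProductSpace ℝ E] (w : ℂ)
    {η : E} (hη : η ≠ 0) : ContDiffAt ℝ ∞ (fun η : E => ((‖η‖ : ℝ) : ℂ) ^ w) η := by
  have h1 : ContDiffAt ℝ ∞ (fun η : E => Complex.exp ((Real.log ‖η‖ : ℂ) * w)) η :=
    ((Complex.ofRealCLM.contDiff.contDiffAt.comp η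
      ((contDiffAt_norm ℝ hη).log (norm_ne_zero_iff.2 hη))).mul contDiffAt_const).cexp
  refine h1.congr_of_eventuallyEq ?_
  filter_upwards [isOpen_ne.mem_nhds hη] with z hz
  rw [Complex.cpow_def_of_ne_zero (by simpa using hz), Complex.ofReal_log (norm_nonneg _)]

theorem norm_iteratedFDeriv_comp_smul_le {E F : Type*} [NormedAddCommGroup E] [NormedSpace ℝ E]
    [NormedAddCommGroup F] [NormedSpace ℝ F] (g : E → F) {r : ℝ} (hr : r ≠ 0) (k : ℕ) (ξ : E) :
    ‖iteratedFDeriv ℝ k (fun η => g (r • η)) ξ‖ ≤ ‖iteratedFDeriv ℝ k g (r • ξ)‖ * |r| ^ k := by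
  let L : E ≃L[ℝ] E := ContinuousLinearEquiv.smulLeft (Units.mk0 r hr)
  have h := L.iteratedFDerivWithin_comp_right g uniqueDiffOn_univ (x := ξ) (mem_univ _) k
  rw [preimage_univ, iteratedFDerivWithin_univ, iteratedFDerivWithin_univ] at h
  have hL : ‖(L : E →L[ℝ] E)‖ ≤ |r| := by
    refine ContinuousLinearMap.opNorm_le_bound _ (abs_nonneg r) fun x => ?_
    exact (norm_smul r x).le
  refine (congrArg norm h).trans_le
    ((ContinuousMultilinearMap.norm_compContinuousLinearMap_le _ _).trans ?_)
  rw [Finset.prod_const, Finset.card_univ, Fintype.card_fin]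
  gcongr
  exact le_rfl

/-- Rescaling by |ξ|⁻¹ moves ξ to the compact unit sphere, where the derivative is bounded. Each
derivative costs a factor |ξ|⁻¹, and the homogeneity factor |ξ|^w has modulus 1. -/
theorem exists_norm_iteratedFDeriv_norm_cpow_le {E : Type*} [NormedAddCommGroup E]
    [InnerProductSpace ℝ E] [FiniteDimensional ℝ E] {w : ℂ} (hw : w.re = 0) (k : ℕ) :
    ∃ C : ℝ, 0 ≤ C ∧ ∀ ξ : E, ξ ≠ 0 →
      ‖iteratedFDeriv ℝ k (fun η : E => ((‖η‖ : ℝ) : ℂ) ^ w) ξ‖ ≤ C * (‖ξ‖⁻¹) ^ k := by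
  obtain ⟨C, hC⟩ := (isCompact_sphere (0 : E) 1).exists_bound_of_continuousOn
    (f := fun ξ => iteratedFDeriv ℝ k (fun η : E => ((‖η‖ : ℝ) : ℂ) ^ w) ξ) (fun ξ hξ =>
      ((contDiffAt_norm_cpow w (ne_zero_of_mem_unit_sphere ⟨ξ, hξ⟩)).continuousAt_iteratedFDeriv
        (mod_cast le_top)).continuousWithinAt)
  refine ⟨max C 0, le_max_right _ _, fun ξ hξ => ?_⟩
  have hr : 0 < ‖ξ‖ := norm_pos_iff.2 hξ
  have hhom : (fun η : E => ((‖η‖ : ℝ) : ℂ) ^ w) =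
      fun η : E => (‖ξ‖ : ℂ) ^ w • ((‖‖ξ‖⁻¹ • η‖ : ℝ) : ℂ) ^ w := by
    ext η
    rw [smul_eq_mul, ← Complex.mul_cpow_ofReal_nonneg hr.le (norm_nonneg _), ← Complex.ofReal_mul,
      norm_smul, norm_inv, norm_norm, mul_inv_cancel_left₀ hr.ne']
  have hcd : ContDiffAt ℝ k (fun η : E => ((‖‖ξ‖⁻¹ • η‖ : ℝ) : ℂ) ^ w) ξ := by
    have h := (contDiffAt_norm_cpow w (smul_ne_zero (inv_ne_zero hr.ne') hξ)).comp ξ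
      (contDiff_const_smul (𝕜 := ℝ) (n := ∞) (‖ξ‖⁻¹)).contDiffAt
    exact h.of_le (mod_cast le_top)
  have hunit : ‖ξ‖⁻¹ • ξ ∈ Metric.sphere (0 : E) 1 := by
    rw [mem_sphere_zero_iff_norm, norm_smul, norm_inv, norm_norm, inv_mul_cancel₀ hr.ne']
  rw [hhom, iteratedFDeriv_const_smul_apply' hcd, norm_smul,
    Complex.norm_cpow_eq_rpow_re_of_pos hr, hw, Real.rpow_zero, one_mul]
  refine (norm_iteratedFDeriv_comp_smul_le (fun η : E => ((‖η‖ : ℝ) : ℂ) ^ w)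
    (inv_ne_zero hr.ne') k ξ).trans ?_
  rw [abs_of_pos (inv_pos.2 hr)]
  gcongr
  exact (hC _ hunit).trans (le_max_left _ _)

theorem isSymbolOfOrder_scatteringSymbol {n : ℕ} {ζ : ℂ} (hre : ζ.re = (n : ℝ) / 2) :
    IsSymbolOfOrder n 0 (scatteringSymbol n ζ) := by
  have hw : (2 * ζ - (n : ℂ)).re = 0 := by simp [hre]; ring
  refine ⟨fun p hp => ?_, fun j k => ?_⟩
  · have h := (contDiffAt_norm_cpow (2 * ζ - (n : ℂ)) (η := p.2) hp).comp p
      (contDiff_snd (𝕜 := ℝ) (n := ∞)).contDiffAt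
    exact (contDiffAt_const.mul h).contDiffWithinAt
  · obtain ⟨C, hC0, hC⟩ := exists_norm_iteratedFDeriv_norm_cpow_le
      (E := EuclideanSpace ℝ (Fin n)) hw k
    set c : ℂ := (2 : ℂ) ^ ((n : ℂ) - 2 * ζ) *
      (Complex.Gamma ((n : ℂ) / 2 - ζ) / Complex.Gamma (ζ - (n : ℂ) / 2)) with hc
    -- The factor 2^k comes from |ξ|⁻¹ ≤ 2 / (1 + |ξ|) for |ξ| ≥ 1.
    refine ⟨‖c‖ * C * 2 ^ k, fun y ξ hξ => ?_⟩
    have hr : 0 < ‖ξ‖ := one_pos.trans_le hξ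
    have hpow : (1 + ‖ξ‖) ^ ((0 : ℝ) - k) = ((1 + ‖ξ‖)⁻¹) ^ k := by
      rw [zero_sub, Real.rpow_neg (by positivity), Real.rpow_natCast, inv_pow]
    have hconst : (fun y' => iteratedFDeriv ℝ k (fun η => scatteringSymbol n ζ y' η) ξ) =
        fun _ => iteratedFDeriv ℝ k
          (fun η : EuclideanSpace ℝ (Fin n) => c • ((‖η‖ : ℝ) : ℂ) ^ (2 * ζ - (n : ℂ))) ξ := rfl
    rw [hconst, hpow]
    rcases eq_or_ne j 0 with rfl | hj
    · rw [norm_iteratedFDeriv_zero, iteratedFDeriv_const_smul_apply'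
        ((contDiffAt_norm_cpow _ (norm_pos_iff.1 hr)).of_le (mod_cast le_top)), norm_smul,
        mul_assoc, mul_assoc]
      refine mul_le_mul_of_nonneg_left ((hC ξ (norm_pos_iff.1 hr)).trans ?_) (norm_nonneg _)
      rw [← mul_pow]
      gcongr
      rw [← div_eq_mul_inv, inv_eq_one_div, div_le_div_iff₀ hr (by positivity)]
      linarith
    · rw [iteratedFDeriv_const_of_ne hj]
      simp only [Pi.zero_apply, norm_zero]
      positivity

/-! ### Matching the leading terms and bounding the error -/

theorem sq_div_four_cpow {r : ℝ} (hr : 0 < r) (s : ℂ) :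
    ((r ^ 2 / 4 : ℝ) : ℂ) ^ s = (2 : ℂ) ^ (-2 * s) * (r : ℂ) ^ (2 * s) := by
  have h0 : (r : ℂ) ≠ 0 := by exact_mod_cast hr.ne'
  rw [Complex.cpow_def_of_ne_zero (by exact_mod_cast (by positivity : r ^ 2 / 4 ≠ 0)),
    Complex.cpow_def_of_ne_zero two_ne_zero, Complex.cpow_def_of_ne_zero h0, ← Complex.exp_add,
    ← Complex.ofReal_log (by positivity), ← Complex.ofReal_log hr.le,
    show (2 : ℂ) = ((2 : ℝ) : ℂ) by norm_num, ← Complex.ofReal_log (by norm_num),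
    Real.log_div (by positivity) (by norm_num), Real.log_pow,
    show (4 : ℝ) = 2 ^ 2 by norm_num, Real.log_pow]
  congr 1
  push_cast
  ring

theorem sq_cpow_neg {x : ℝ} (hx : 0 < x) (s : ℂ) :
    ((x ^ 2 : ℝ) : ℂ) ^ (-s) = (x : ℂ) ^ (-(2 * s)) := by
  have h0 : (x : ℂ) ≠ 0 := by exact_mod_cast hx.ne'
  rw [Complex.cpow_def_of_ne_zero (by exact_mod_cast (by positivity : x ^ 2 ≠ 0)),
    Complex.cpow_def_of_ne_zero h0, ← Complex.ofReal_log (by positivity),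
    ← Complex.ofReal_log hx.le, Real.log_pow]
  congr 1
  push_cast
  ring

theorem Gamma_ne_zero_of_re_eq_zero {s : ℂ} (hs : s.re = 0) (hs0 : s ≠ 0) :
    Complex.Gamma s ≠ 0 := by
  refine Complex.Gamma_ne_zero fun m hm => hs0 ?_
  have h := congrArg Complex.re hm
  rw [hs, Complex.neg_re, Complex.natCast_re] at h
  have : (m : ℝ) = 0 := by linarith
  rw [hm, Nat.cast_eq_zero.1 this]
  simp

theorem integrable_cpow_mul_exp_mul_fourierHat {n : ℕ} {f : EuclideanSpace ℝ (Fin n) → ℂ}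
    (hn : 1 ≤ n) (hf : ContDiff ℝ ∞ f) (hc : HasCompactSupport f) {s : ℂ} (hs : s.re = 0)
    (y : EuclideanSpace ℝ (Fin n)) :
    Integrable fun ξ : EuclideanSpace ℝ (Fin n) => ((‖ξ‖ ^ 2 / 4 : ℝ) : ℂ) ^ s *
      (Complex.exp (Complex.I * ((inner ℝ y ξ : ℝ) : ℂ)) * fourierHat n f ξ) := by
  have : NeZero n := ⟨by omega⟩
  have h := integrable_fourierHat hf hc
  have h2 : Measurable fun ξ : EuclideanSpace ℝ (Fin n) => (inner ℝ y ξ : ℝ) :=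
    (by fun_prop : Continuous _).measurable
  have h3 := (continuous_fourierHat hf hc).measurable
  refine h.mono (by fun_prop : Measurable _).aestronglyMeasurable ?_
  filter_upwards [compl_mem_ae_iff.2 (measure_singleton (0 : EuclideanSpace ℝ (Fin n)))] with ξ hξ
  have hξ : 0 < ‖ξ‖ := norm_pos_iff.2 hξ
  rw [norm_mul, norm_mul, Complex.norm_cpow_eq_rpow_re_of_pos (by positivity), hs, Real.rpow_zero,
    mul_comm Complex.I, Complex.norm_exp_ofReal_mul_I, one_mul, one_mul]

/-- The term x^(-2s) Γ(s) gives x^(n-ζ) f by Fourier inversion, as ζ - 2s = n - ζ. The term l^s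
Γ(-s) gives S_ζ f, as (|ξ|²/4)^s = 2^(n-2ζ) |ξ|^(2ζ-n) for ξ ≠ 0. -/
theorem poissonIntegral_sub_eq {n : ℕ} {ζ : ℂ} {f : EuclideanSpace ℝ (Fin n) → ℂ} (hn : 1 ≤ n)
    (hre : ζ.re = (n : ℝ) / 2) (hne : ζ ≠ (n : ℂ) / 2) (hf : ContDiff ℝ ∞ f)
    (hc : HasCompactSupport f) {x : ℝ} (hx : 0 < x) (y : EuclideanSpace ℝ (Fin n)) :
    poissonIntegral n ζ f x y -
        ((x : ℂ) ^ ((n : ℂ) - ζ) * f y + (x : ℂ) ^ ζ * scatteringOp n ζ f y) =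
      (x : ℂ) ^ ζ * (Complex.Gamma (ζ - (n : ℂ) / 2))⁻¹ * ((2 * (Real.pi : ℂ)) ^ n)⁻¹ *
      ∫ ξ : EuclideanSpace ℝ (Fin n),
        (macdonaldIntegral (ζ - (n : ℂ) / 2) x (‖ξ‖ ^ 2 / 4) -
          (((x ^ 2 : ℝ) : ℂ) ^ (-(ζ - (n : ℂ) / 2)) * Complex.Gamma (ζ - (n : ℂ) / 2) +
            ((‖ξ‖ ^ 2 / 4 : ℝ) : ℂ) ^ (ζ - (n : ℂ) / 2) *
              Complex.Gamma (-(ζ - (n : ℂ) / 2)))) *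
        (Complex.exp (Complex.I * ((inner ℝ y ξ : ℝ) : ℂ)) * fourierHat n f ξ) := by
  have : NeZero n := ⟨by omega⟩
  obtain ⟨s, hsdef⟩ : ∃ s, s = ζ - (n : ℂ) / 2 := ⟨_, rfl⟩
  have hs : s.re = 0 := by simp [hsdef, hre]
  have hs0 : s ≠ 0 := by rw [hsdef]; exact sub_ne_zero.2 hne
  have hG := Gamma_ne_zero_of_re_eq_zero hs hs0
  have h0 : (x : ℂ) ≠ 0 := by exact_mod_cast hx.ne'
  have hK := integrable_exp_mul_fourierHat_mul_macdonald hn hs hf hc hx y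
  have hE : Integrable fun ξ : EuclideanSpace ℝ (Fin n) =>
      Complex.exp (Complex.I * ((inner ℝ y ξ : ℝ) : ℂ)) * fourierHat n f ξ := by
    have h := integrable_cpow_mul_exp_mul_fourierHat hn hf hc (s := 0) (by simp) y
    simpa using h
  have hA := hE.const_mul (((x ^ 2 : ℝ) : ℂ) ^ (-s) * Complex.Gamma s)
  have hKA : Integrable fun ξ : EuclideanSpace ℝ (Fin n) =>
      macdonaldIntegral s x (‖ξ‖ ^ 2 / 4) *
        (Complex.exp (Complex.I * ((inner ℝ y ξ : ℝ) : ℂ)) * fourierHat n f ξ) -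
      (((x ^ 2 : ℝ) : ℂ) ^ (-s) * Complex.Gamma s) *
        (Complex.exp (Complex.I * ((inner ℝ y ξ : ℝ) : ℂ)) * fourierHat n f ξ) := hK.sub hA
  have hB := (integrable_cpow_mul_exp_mul_fourierHat hn hf hc hs y).const_mul
    (Complex.Gamma (-s))
  have hS : scatteringOp n ζ f y = ((2 * (Real.pi : ℂ)) ^ n)⁻¹ * (Complex.Gamma s)⁻¹ *
      ∫ ξ : EuclideanSpace ℝ (Fin n), Complex.Gamma (-s) * (((‖ξ‖ ^ 2 / 4 : ℝ) : ℂ) ^ s *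
        (Complex.exp (Complex.I * ((inner ℝ y ξ : ℝ) : ℂ)) * fourierHat n f ξ)) := by
    rw [scatteringOp, pseudoDiffOp, mul_assoc, ← integral_const_mul (Complex.Gamma s)⁻¹]
    congr 1
    refine integral_congr_ae ?_
    filter_upwards [compl_mem_ae_iff.2 (measure_singleton (0 : EuclideanSpace ℝ (Fin n)))]
      with ξ hξ
    have hξ : 0 < ‖ξ‖ := norm_pos_iff.2 hξ
    rw [sq_div_four_cpow hξ, scatteringSymbol, show (n : ℂ) - 2 * ζ = -2 * s by rw [hsdef]; ring,
      show (n : ℂ) / 2 - ζ = -s by rw [hsdef]; ring, ← hsdef,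
      show 2 * ζ - (n : ℂ) = 2 * s by rw [hsdef]; ring]
    ring
  have hF : (x : ℂ) ^ ((n : ℂ) - ζ) * f y = (x : ℂ) ^ ζ * (Complex.Gamma s)⁻¹ *
      ((2 * (Real.pi : ℂ)) ^ n)⁻¹ * ∫ ξ : EuclideanSpace ℝ (Fin n),
        (((x ^ 2 : ℝ) : ℂ) ^ (-s) * Complex.Gamma s) *
        (Complex.exp (Complex.I * ((inner ℝ y ξ : ℝ) : ℂ)) * fourierHat n f ξ) := by
    rw [integral_const_mul, ← fourierHat_inversion hf hc y, sq_cpow_neg hx,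
      show (n : ℂ) - ζ = ζ + -(2 * s) by rw [hsdef]; ring, Complex.cpow_add _ _ h0]
    field_simp
  rw [poissonIntegral_eq_fourier hn hre hne hf hc hx y, hS, hF, ← hsdef]
  have hsplit : ∀ ξ : EuclideanSpace ℝ (Fin n),
      (macdonaldIntegral s x (‖ξ‖ ^ 2 / 4) - (((x ^ 2 : ℝ) : ℂ) ^ (-s) * Complex.Gamma s +
        ((‖ξ‖ ^ 2 / 4 : ℝ) : ℂ) ^ s * Complex.Gamma (-s))) *
        (Complex.exp (Complex.I * ((inner ℝ y ξ : ℝ) : ℂ)) * fourierHat n f ξ) =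
      macdonaldIntegral s x (‖ξ‖ ^ 2 / 4) *
        (Complex.exp (Complex.I * ((inner ℝ y ξ : ℝ) : ℂ)) * fourierHat n f ξ) -
      (((x ^ 2 : ℝ) : ℂ) ^ (-s) * Complex.Gamma s) *
        (Complex.exp (Complex.I * ((inner ℝ y ξ : ℝ) : ℂ)) * fourierHat n f ξ) -
      Complex.Gamma (-s) * (((‖ξ‖ ^ 2 / 4 : ℝ) : ℂ) ^ s *
        (Complex.exp (Complex.I * ((inner ℝ y ξ : ℝ) : ℂ)) * fourierHat n f ξ)) := by
    intro ξ; ring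
  simp only [hsplit]
  rw [integral_sub hKA hB, integral_sub hK hA]
  ring

theorem mainTheorem8 (n : ℕ) (hn : 1 ≤ n) (ζ : ℂ) (hre : ζ.re = (n : ℝ) / 2)
    (hne : ζ ≠ (n : ℂ) / 2) :
    IsSymbolOfOrder n 0 (scatteringSymbol n ζ) ∧
    ∀ f : EuclideanSpace ℝ (Fin n) → ℂ, ContDiff ℝ ∞ f → HasCompactSupport f →
      ∃ C : ℝ, ∀ x : ℝ, 0 < x → x ≤ 1 → ∀ y : EuclideanSpace ℝ (Fin n),
        ‖poissonIntegral n ζ f x y -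
            ((x : ℂ) ^ ((n : ℂ) - ζ) * f y + (x : ℂ) ^ ζ * scatteringOp n ζ f y)‖ ≤
          C * x ^ ((n : ℝ) / 2 + 1) := by
  refine ⟨isSymbolOfOrder_scatteringSymbol hre, fun f hf hc => ?_⟩
  have : NeZero n := ⟨by omega⟩
  have hs : (ζ - (n : ℂ) / 2).re = 0 := by simp [hre]
  have hs0 : ζ - (n : ℂ) / 2 ≠ 0 := sub_ne_zero.2 hne
  have hint : Integrable fun ξ => (1 + ‖ξ‖ ^ 2 / 4) * ‖fourierHat n f ξ‖ := by
    refine ((integrable_fourierHat hf hc).norm.add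
      ((integrable_sq_norm_mul_norm_fourierHat hf hc).div_const 4)).congr
      (Eventually.of_forall fun ξ => ?_)
    simp only [Pi.add_apply]
    ring
  -- The remainder bound 2x(1 + l) at l = |ξ|²/4, integrated against |f̂|, with the prefactors of
  -- `poissonIntegral_sub_eq`.
  refine ⟨‖(Complex.Gamma (ζ - (n : ℂ) / 2))⁻¹‖ * ‖((2 * (Real.pi : ℂ)) ^ n)⁻¹‖ *
    (2 * ∫ ξ, (1 + ‖ξ‖ ^ 2 / 4) * ‖fourierHat n f ξ‖), fun x hx _ y => ?_⟩
  rw [poissonIntegral_sub_eq hn hre hne hf hc hx y, norm_mul, norm_mul, norm_mul,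
    Complex.norm_cpow_eq_rpow_re_of_pos hx, hre, Real.rpow_add hx, Real.rpow_one]
  have hbound := norm_integral_le_of_norm_le (hint.const_mul (2 * x))
    (f := fun ξ : EuclideanSpace ℝ (Fin n) =>
        (macdonaldIntegral (ζ - (n : ℂ) / 2) x (‖ξ‖ ^ 2 / 4) -
          (((x ^ 2 : ℝ) : ℂ) ^ (-(ζ - (n : ℂ) / 2)) * Complex.Gamma (ζ - (n : ℂ) / 2) +
            ((‖ξ‖ ^ 2 / 4 : ℝ) : ℂ) ^ (ζ - (n : ℂ) / 2) *
              Complex.Gamma (-(ζ - (n : ℂ) / 2)))) *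
        (Complex.exp (Complex.I * ((inner ℝ y ξ : ℝ) : ℂ)) * fourierHat n f ξ)) (by
      -- The remainder bound needs l > 0, so the origin is discarded; it is a null set because n ≥
      -- 1.
      filter_upwards [compl_mem_ae_iff.2 (measure_singleton (0 : EuclideanSpace ℝ (Fin n)))]
        with ξ hξ
      have hξ : 0 < ‖ξ‖ := norm_pos_iff.2 hξ
      rw [norm_mul, norm_mul, mul_comm Complex.I, Complex.norm_exp_ofReal_mul_I, one_mul,
        ← mul_assoc]
      gcongr
      exact norm_integral_besselKernel_sub_le hs hs0 hx (by positivity))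
  rw [integral_const_mul] at hbound
  calc _ ≤ x ^ ((n : ℝ) / 2) * ‖(Complex.Gamma (ζ - (n : ℂ) / 2))⁻¹‖ *
        ‖((2 * (Real.pi : ℂ)) ^ n)⁻¹‖ *
        (2 * x * ∫ ξ, (1 + ‖ξ‖ ^ 2 / 4) * ‖fourierHat n f ξ‖) := by gcongr
    _ = _ := by ring
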